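/- Fix constants $P>0$ and $\eta>0$ and put $\rho=P/\eta$. For each $n\ge 1$ consider a network of $n$ transmitter–receiver pairs (links) $1,\dots,n$, with channel gains $g_{ji}$ (from transmitter $j$ to receiver $i$), $1\le i,j\le n$, that are independent and exponentially distributed with mean $1$. For a set $\mathcal A\subseteq\{1,\dots,n\}$ of active links define the throughput $$T(\mathcal A)=\sum_{i\in\mathcal A}\log\Bigl(1+\frac{g_{ii}}{1/\rho+\sum_{j\in\mathcal A,\,j\ne i}g_{ji}}\Bigr),\qquad T^*=\max_{\mathcal A\subseteq\{1,\dots,n\}}T(\mathcal A),$$ where $\log$ is the natural logarithm. For a threshold $\Delta$, the decentralized threshold-based link activation strategy (TBLAS) activates the set $\mathcal A_\Delta=\{i: g_{ii}>\Delta\}$. Events $E_n$ hold asymptotically almost surely (a.a.s.) if $\mathrm P(E_n)\to1$ as $n\to\infty$, and random variables $X_n$ satisfy $X_n\sim f(n)$ a.a.s. if for every $\varepsilon>0$ one has $|X_n/f(n)-1|\le\varepsilon$ a.a.s. **Theorem.** The maximum throughput satisfies $T^*\sim\log n$ a.a.s. Moreover, this scaling is a.a.s. achieved by TBLAS: for every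 deterministic sequence of thresholds $$\Delta_n=\log n-2\log\log n+\log 2+O\Bigl(\frac{\log\log n}{\log n}\Bigr),$$ one has $T(\mathcal A_{\Delta_n})\sim\log n$ a.a.s. -/

import Mathlib

open MeasureTheory ProbabilityTheory Filter Asymptotics
open scoped Topology

noncomputable section

/-- Asymptotically almost surely: the probability of the `n`-th event tends to one. -/
def AAS {Ω : ℕ → Type*} [∀ n, MeasurableSpace (Ω n)] (μ : ∀ n, Measure (Ω n))
    (E : ∀ n, Set (Ω n)) : Prop :=
  Tendsto (fun n => μ n (E n)) atTop (𝓝 1)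

/-- `X n ∼ f n` a.a.s.: the ratio of the random variable `X n` to the deterministic
quantity `f n` is a.a.s. within any prescribed distance of one. -/
def AASEquiv {Ω : ℕ → Type*} [∀ n, MeasurableSpace (Ω n)] (μ : ∀ n, Measure (Ω n))
    (X : ∀ n, Ω n → ℝ) (f : ℕ → ℝ) : Prop :=
  ∀ ε : ℝ, 0 < ε → AAS μ (fun n => {ω | |X n ω / f n - 1| ≤ ε})

namespace Network

variable {n : ℕ}

/-- Signal-to-interference-plus-noise ratio of link `i` when `A` is the set of active links.
`ρ` is the transmit SNR and `g j i` is the gain from transmitter `j` to receiver `i`. -/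
def sinr (ρ : ℝ) (g : Fin n → Fin n → ℝ) (A : Finset (Fin n)) (i : Fin n) : ℝ :=
  g i i / (1 / ρ + ∑ j ∈ A.erase i, g j i)

/-- Maximum supportable rate of link `i`, in nats per channel use. -/
def rate (ρ : ℝ) (g : Fin n → Fin n → ℝ) (A : Finset (Fin n)) (i : Fin n) : ℝ :=
  Real.log (1 + sinr ρ g A i)

/-- Throughput of the network when `A` is the set of active links. -/
def throughput (ρ : ℝ) (g : Fin n → Fin n → ℝ) (A : Finset (Fin n)) : ℝ :=
  ∑ i ∈ A, rate ρ g A i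

/-- The maximum of the throughput over all sets of active links. -/
def maxThroughput (ρ : ℝ) (g : Fin n → Fin n → ℝ) : ℝ :=
  (Finset.univ : Finset (Finset (Fin n))).sup' Finset.univ_nonempty (throughput ρ g)

/-- The set of active links chosen by the threshold-based link activation strategy:
link `i` is active iff its direct channel gain exceeds the threshold `Δ`. -/
def tblas (Δ : ℝ) (g : Fin n → Fin n → ℝ) : Finset (Fin n) :=
  Finset.univ.filter (fun i => Δ < g i i)

end Network

end

/-! ### Exponential laws: tails, moments, and comparison of exponential moments. -/

section Exponential

/-! Upper bound. Fix a set of `m + 1` links. Dropping the noise, a link's rate exceeds `r / m` with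
probability at most the Laplace transform of its interference at `exp (r / m) - 1`, which is exactly
`exp (-r)`. So `m` times each rate is dominated by an Exp(1) variable. Rates at different receivers
use disjoint columns of gains, hence are independent, and Chernoff (`measureReal_lt_throughput_le`)
beats the union bound over the at most `n ^ (m + 1)` sets once `m` is at least a constant `K`. Sets
of at most `K` links have throughput `O(log log n)`, because all direct gains are at most `2 log n`
with high probability.

Lower bound. About `n * exp (-Δ)`, of order `(log n)²`, links are active, and the active set is
independent of the cross gains. The total interference among `k` active links is thus at most about
`k²`, while noise and `Δ` are negligible against `k`. From `log (1 + x) ≥ x / (1 + x)` and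
Cauchy–Schwarz, the throughput is at least nearly `Δ ∼ log n` (`le_throughput`).

TBLAS bounds the maximum from below and the maximum bounds TBLAS from above, so these two tails give
both claims. -/

theorem lintegral_exp_mul_expMeasure {t : ℝ} (ht : t < 1) :
    ∫⁻ x, ENNReal.ofReal (Real.exp (t * x)) ∂(expMeasure 1) = ENNReal.ofReal (1 - t)⁻¹ := by
  have h1 : 0 < 1 - t := by linarith
  have hm (r : ℝ) : Measurable (exponentialPDF r) :=
    (measurable_exponentialPDFReal r).ennreal_ofReal
  change ∫⁻ x, _ ∂(volume.withDensity (exponentialPDF 1)) = _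
  rw [lintegral_withDensity_eq_lintegral_mul _ (hm 1) (by fun_prop)]
  have : ∀ x, (exponentialPDF 1 * fun x => ENNReal.ofReal (Real.exp (t * x))) x
      = ENNReal.ofReal (1 - t)⁻¹ * exponentialPDF (1 - t) x := by
    intro x
    simp only [Pi.mul_apply, exponentialPDF_eq]
    split_ifs with hx
    · rw [← ENNReal.ofReal_mul (by positivity), ← ENNReal.ofReal_mul (by positivity),
        inv_mul_cancel_left₀ h1.ne', one_mul, ← Real.exp_add]
      ring_nf
    · simp
  simp_rw [this]
  rw [lintegral_const_mul _ (hm _),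
    lintegral_exponentialPDF_eq_one h1, mul_one]

theorem expMeasure_Ioi {s : ℝ} (hs : 0 ≤ s) :
    expMeasure 1 (Set.Ioi s) = ENNReal.ofReal (Real.exp (-s)) := by
  have := isProbabilityMeasure_expMeasure one_pos
  have h := cdf_expMeasure_eq one_pos s
  rw [if_pos hs, cdf_eq_real] at h
  rw [← ofReal_measureReal, ← Set.compl_Iic, probReal_compl_eq_one_sub measurableSet_Iic, h]
  simp

variable {Ω : Type*} [MeasurableSpace Ω] {μ : Measure Ω} {X Y : Ω → ℝ}

theorem ae_pos_of_hasLaw_exp [IsProbabilityMeasure μ]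
    (hX : HasLaw X (expMeasure 1) μ) : ∀ᵐ ω ∂μ, 0 < X ω := by
  have h : μ {ω | 0 < X ω} = 1 := by
    rw [hX.measure_eq measurableSet_Ioi]
    exact (expMeasure_Ioi le_rfl).trans (by simp)
  have := (prob_compl_eq_zero_iff₀ (nullMeasurableSet_lt aemeasurable_const hX.aemeasurable)).2 h
  exact this

theorem lintegral_exp_mul_of_hasLaw_exp (hX : HasLaw X (expMeasure 1) μ) {t : ℝ} (ht : t < 1) :
    ∫⁻ ω, ENNReal.ofReal (Real.exp (t * X ω)) ∂μ = ENNReal.ofReal (1 - t)⁻¹ := by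
  rw [← lintegral_exp_mul_expMeasure ht, ← hX.lintegral_comp (by fun_prop)]

theorem integrable_exp_mul_of_hasLaw_exp (hX : HasLaw X (expMeasure 1) μ) {t : ℝ} (ht : t < 1) :
    Integrable (fun ω => Real.exp (t * X ω)) μ := by
  have := hX.aemeasurable
  refine ⟨by fun_prop, ?_⟩
  rw [hasFiniteIntegral_iff_ofReal (ae_of_all _ fun _ => by positivity),
    lintegral_exp_mul_of_hasLaw_exp hX ht]
  exact ENNReal.ofReal_lt_top

theorem mgf_of_hasLaw_exp (hX : HasLaw X (expMeasure 1) μ) {t : ℝ} (ht : t < 1) :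
    mgf X μ t = (1 - t)⁻¹ := by
  have := hX.aemeasurable
  rw [mgf, integral_eq_lintegral_of_nonneg_ae (ae_of_all _ fun _ => by positivity)
    (by fun_prop), lintegral_exp_mul_of_hasLaw_exp hX ht, ENNReal.toReal_ofReal]
  exact inv_nonneg.2 (by linarith)

theorem measureReal_lt_of_hasLaw_exp (hX : HasLaw X (expMeasure 1) μ) {s : ℝ} (hs : 0 ≤ s) :
    μ.real {ω | s < X ω} = Real.exp (-s) := by
  rw [measureReal_def, hX.measure_eq measurableSet_Ioi]
  change (expMeasure 1 (Set.Ioi s)).toReal = _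
  rw [expMeasure_Ioi hs, ENNReal.toReal_ofReal (by positivity)]

/-- An exponential variable exceeds `s * Y`, for an independent `Y ≥ 0`, with probability given
by the Laplace transform of `Y` at `s`. -/
theorem measureReal_mul_lt_eq_mgf [IsProbabilityMeasure μ]
    (hX : HasLaw X (expMeasure 1) μ) (hY : Measurable Y)
    (hY0 : ∀ ω, 0 ≤ Y ω) (hXY : IndepFun Y X μ) {s : ℝ} (hs : 0 ≤ s) :
    μ.real {ω | s * Y ω < X ω} = mgf Y μ (-s) := by
  have := isProbabilityMeasure_expMeasure one_pos
  have hS : MeasurableSet {p : ℝ × ℝ | s * p.1 < p.2} :=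
    measurableSet_lt (by fun_prop) (by fun_prop)
  have hmap := hXY.map_prod_eq_prod_map_map hY.aemeasurable hX.aemeasurable
  rw [hX.map_eq] at hmap
  have h : μ {ω | s * Y ω < X ω} = ∫⁻ ω, ENNReal.ofReal (Real.exp (-s * Y ω)) ∂μ := by
    have h1 : μ {ω | s * Y ω < X ω} = (μ.map fun ω => (Y ω, X ω)) {p | s * p.1 < p.2} := by
      rw [Measure.map_apply_of_aemeasurable (hY.aemeasurable.prodMk hX.aemeasurable) hS]
      rfl
    rw [h1, hmap, Measure.prod_apply hS, lintegral_map (measurable_measure_prodMk_left hS) hY]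
    refine lintegral_congr fun ω => ?_
    rw [neg_mul, ← expMeasure_Ioi (mul_nonneg hs (hY0 ω))]
    rfl
  rw [mgf, integral_eq_lintegral_of_nonneg_ae (ae_of_all _ fun _ => by positivity)
    (by fun_prop), ← h]
  rfl

/-- A nonnegative variable whose tail is at most `exp (-r)` has exponential moments at most those
of the exponential law. -/
theorem lintegral_exp_mul_le_of_tail [IsProbabilityMeasure μ] (hY : Measurable Y)
    (h : ∀ r, 0 ≤ r → μ.real {ω | r < Y ω} ≤ Real.exp (-r)) {θ : ℝ} (h0 : 0 < θ) (h1 : θ < 1) :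
    ∫⁻ ω, ENNReal.ofReal (Real.exp (θ * Y ω)) ∂μ ≤ ENNReal.ofReal (1 - θ)⁻¹ := by
  have hexp := isProbabilityMeasure_expMeasure one_pos
  rw [← lintegral_exp_mul_expMeasure h1,
    lintegral_eq_lintegral_meas_lt _ (ae_of_all _ fun _ => by positivity) (by fun_prop),
    lintegral_eq_lintegral_meas_lt _ (ae_of_all _ fun _ => by positivity) (by fun_prop)]
  refine setLIntegral_mono' measurableSet_Ioi fun t ht => ?_
  have ht : 0 < t := ht
  have hE : ∀ x : ℝ, t < Real.exp (θ * x) ↔ Real.log t / θ < x := fun x => by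
    rw [div_lt_iff₀ h0, mul_comm x, Real.log_lt_iff_lt_exp ht]
  simp_rw [hE]
  rcases le_total 0 (Real.log t / θ) with hr | hr
  · have := expMeasure_Ioi hr
    rw [Set.Ioi] at this
    rw [this, ← ofReal_measureReal]
    exact ENNReal.ofReal_le_ofReal (h _ hr)
  -- At a nonpositive level the exponential tail is already 1, so no information on `Y` is needed.
  · have h2 : expMeasure 1 {x | Real.log t / θ < x} = 1 := by
      refine le_antisymm prob_le_one ?_
      have h3 := expMeasure_Ioi (le_refl (0:ℝ))
      simp only [neg_zero, Real.exp_zero, ENNReal.ofReal_one] at h3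
      rw [← h3]
      exact measure_mono fun x hx => lt_of_le_of_lt hr hx
    rw [h2]
    exact prob_le_one

end Exponential

/-! ### Rayleigh gains and the upper tail of the throughput. -/

namespace Network

/-- Channel gains that are everywhere positive, measurable, independent and exponentially
distributed with mean one. -/
structure RayleighGains {n : ℕ} {Ω : Type*} [MeasurableSpace Ω] (μ : Measure Ω)
    (g : Fin n → Fin n → Ω → ℝ) : Prop where
  measurable : ∀ j i, Measurable (g j i)
  pos : ∀ j i ω, 0 < g j i ω
  law : ∀ j i, HasLaw (g j i) (expMeasure 1) μ
  indep : iIndepFun (fun p : Fin n × Fin n => g p.1 p.2) μ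

variable {n : ℕ} {Ω : Type*} [MeasurableSpace Ω] {μ : Measure Ω}
  {g : Fin n → Fin n → Ω → ℝ} {ρ : ℝ}

/-- The laws give measurability and positivity only almost everywhere; changing the gains on a null
set (to the value 1 where a measurable version is not positive) makes both hold everywhere. -/
theorem exists_rayleighGains_ae_eq [IsProbabilityMeasure μ]
    (hlaw : ∀ j i, HasLaw (g j i) (expMeasure 1) μ)
    (hindep : iIndepFun (fun p : Fin n × Fin n => g p.1 p.2) μ) :
    ∃ g' : Fin n → Fin n → Ω → ℝ, RayleighGains μ g' ∧
      ∀ᵐ ω ∂μ, (fun j i => g j i ω) = fun j i => g' j i ω := by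
  have hm := fun j i => (hlaw j i).aemeasurable
  let m : Fin n → Fin n → Ω → ℝ := fun j i => (hm j i).mk
  let g' : Fin n → Fin n → Ω → ℝ := fun j i ω => if 0 < m j i ω then m j i ω else 1
  have hmm : ∀ j i, Measurable (m j i) := fun j i => (hm j i).measurable_mk
  have hae : ∀ j i, g j i =ᵐ[μ] g' j i := fun j i => by
    filter_upwards [(hm j i).ae_eq_mk, ae_pos_of_hasLaw_exp (hlaw j i)] with ω h1 h2
    have h3 : g j i ω = m j i ω := h1
    simp only [g', ← h3, if_pos h2]
  refine ⟨g', ⟨fun j i => ?_, fun j i ω => ?_, fun j i => (hlaw j i).congr (hae j i).symm,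
    hindep.congr fun p => hae p.1 p.2⟩, ?_⟩
  · exact Measurable.ite (measurableSet_lt measurable_const (hmm j i)) (hmm j i) measurable_const
  · simp only [g']
    split_ifs with h
    · exact h
    · exact one_pos
  · filter_upwards [ae_all_iff.2 fun j => ae_all_iff.2 fun i => hae j i] with ω h
    funext j i
    exact h j i

namespace RayleighGains

theorem iIndepFun_column (hg : RayleighGains μ g) (i : Fin n) : iIndepFun (fun j => g j i) μ :=
  hg.indep.precomp (g := fun j => (j, i)) fun _ _ h => (Prod.ext_iff.1 h).1

/-- Interference power at receiver `i` has the Laplace transform of a Gamma variable. -/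
theorem mgf_interference (hg : RayleighGains μ g) (B : Finset (Fin n)) (i : Fin n) {t : ℝ}
    (ht : t < 1) : mgf (fun ω => ∑ j ∈ B, g j i ω) μ t = ((1 - t)⁻¹) ^ B.card := by
  have h := (hg.iIndepFun_column i).mgf_sum (t := t) (fun j => hg.measurable j i) B
  rw [Finset.prod_congr rfl fun j _ => mgf_of_hasLaw_exp (hg.law j i) ht, Finset.prod_const] at h
  rw [← h]
  congr 1
  ext ω
  simp

theorem sinr_pos (hg : RayleighGains μ g) (hρ : 0 < ρ) (A : Finset (Fin n)) (i : Fin n) (ω : Ω) :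
    0 < sinr ρ (fun j i => g j i ω) A i :=
  div_pos (hg.pos i i ω)
    (add_pos_of_pos_of_nonneg (by positivity) (Finset.sum_nonneg fun j _ => (hg.pos j i ω).le))

theorem measurable_rate (hg : RayleighGains μ g) (A : Finset (Fin n)) (i : Fin n) :
    Measurable fun ω => rate ρ (fun j i => g j i ω) A i := by
  have := hg.measurable
  unfold rate sinr
  fun_prop

/-- The rate of a link facing `m` active interferers, multiplied by `m`, has a tail at most that
of an exponential variable. -/
theorem measureReal_lt_rate_le [IsProbabilityMeasure μ]
    (hg : RayleighGains μ g) (hρ : 0 < ρ) {A : Finset (Fin n)}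
    {i : Fin n} (hi : i ∈ A) {m : ℕ} (hA : A.card = m + 1) {r : ℝ} (hr : 0 ≤ r) :
    μ.real {ω | r < m * rate ρ (fun j i => g j i ω) A i} ≤ Real.exp (-r) := by
  rcases Nat.eq_zero_or_pos m with rfl | hm
  · simp [hr.not_gt, (Real.exp_pos _).le]
  have hm' : (0:ℝ) < m := by exact_mod_cast hm
  have hcard : (A.erase i).card = m := by rw [Finset.card_erase_of_mem hi, hA]; rfl
  -- Chosen so that the Laplace transform `(1 + s)⁻ᵐ` of the interference equals `exp (-r)`.
  set s : ℝ := Real.exp (r / m) - 1 with hs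
  have hs0 : 0 ≤ s := by
    have := Real.add_one_le_exp (r / m)
    have : 0 ≤ r / m := by positivity
    linarith
  have hind : IndepFun (fun ω => ∑ j ∈ A.erase i, g j i ω) (g i i) μ := by
    have := (hg.iIndepFun_column i).indepFun_finsetSum_of_notMem
      (fun j => hg.measurable j i) (Finset.notMem_erase i A)
    convert this using 1
    ext ω
    simp
  have hsum0 : ∀ ω, 0 ≤ ∑ j ∈ A.erase i, g j i ω :=
    fun ω => Finset.sum_nonneg fun j _ => (hg.pos j i ω).le
  calc μ.real {ω | r < m * rate ρ (fun j i => g j i ω) A i}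
      ≤ μ.real {ω | s * ∑ j ∈ A.erase i, g j i ω < g i i ω} := by
        refine measureReal_mono fun ω hω => ?_
        simp only [Set.mem_ofPred_eq] at hω ⊢
        have h1 : r / m < rate ρ (fun j i => g j i ω) A i := by
          rwa [div_lt_iff₀ hm', mul_comm]
        rw [rate, Real.lt_log_iff_exp_lt (by linarith [hg.sinr_pos hρ A i ω])] at h1
        have h2 : s < sinr ρ (fun j i => g j i ω) A i := by linarith
        rw [sinr, lt_div_iff₀ (add_pos_of_pos_of_nonneg (by positivity) (hsum0 ω))] at h2
        -- The noise term is discarded here.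
        have : 0 ≤ s * (1 / ρ) := by positivity
        linarith
    _ = mgf (fun ω => ∑ j ∈ A.erase i, g j i ω) μ (-s) :=
        measureReal_mul_lt_eq_mgf (hg.law i i)
          (Finset.measurable_sum _ fun j _ => hg.measurable j i) hsum0 hind hs0
    _ = Real.exp (-r) := by
        rw [hg.mgf_interference _ _ (by linarith), hcard, hs, ← Real.exp_zero]
        rw [show Real.exp 0 - -(Real.exp (r / m) - Real.exp 0) = Real.exp (r / m) by ring,
          ← Real.exp_neg, ← Real.exp_nat_mul]
        congr 1
        field_simp

/-- Column `i` contains every gain into receiver `i`, and distinct columns are disjoint families of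
independent gains. This is the independence of the rates within a fixed active set. -/
theorem lintegral_prod_columns [IsProbabilityMeasure μ]
    (hg : RayleighGains μ g) {F : Fin n → (Fin n → ℝ) → ENNReal}
    (hF : ∀ i, Measurable (F i)) (s : Finset (Fin n)) :
    ∫⁻ ω, ∏ i ∈ s, F i (fun j => g j i ω) ∂μ = ∏ i ∈ s, ∫⁻ ω, F i (fun j => g j i ω) ∂μ := by
  have hgm := hg.measurable
  induction s using Finset.induction_on with
  | empty => simp
  | insert i s hi ih =>
    simp only [Finset.prod_insert hi]
    rw [← ih]
    refine lintegral_mul_eq_lintegral_mul_lintegral_of_indepFun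
      (f := fun ω => F i fun j => g j i ω) (g := fun ω => ∏ i ∈ s, F i fun j => g j i ω)
      (by fun_prop) (by fun_prop) ?_
    let S : Finset (Fin n × Fin n) := Finset.univ.filter fun p => p.2 = i
    let T : Finset (Fin n × Fin n) := Finset.univ.filter fun p => p.2 ∈ s
    have hST : Disjoint S T := by
      rw [Finset.disjoint_left]
      rintro p hp hp'
      simp only [S, T, Finset.mem_filter, Finset.mem_univ, true_and] at hp hp'
      exact hi (hp ▸ hp')
    have h := hg.indep.indepFun_finset S T hST (fun p => hg.measurable p.1 p.2)
    let φ : (S → ℝ) → ENNReal := fun x => F i fun j => x ⟨(j, i), by simp [S]⟩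
    let ψ : (T → ℝ) → ENNReal := fun x =>
      ∏ k ∈ s.attach, F k.1 fun j => x ⟨(j, k.1), by simp [T]⟩
    have h2 := h.comp (φ := φ) (ψ := ψ) (by fun_prop) (by fun_prop)
    have e : (fun ω => ∏ i ∈ s, F i fun j => g j i ω) =
        ψ ∘ fun ω (p : T) => g p.1.1 p.1.2 ω := by
      ext ω
      exact (Finset.prod_attach s fun k => F k fun j => g j k ω).symm
    rw [e]
    exact h2

/-- Chernoff bound for the throughput of a fixed set of `m + 1` active links. -/
theorem measureReal_lt_throughput_le [IsProbabilityMeasure μ]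
    (hg : RayleighGains μ g) (hρ : 0 < ρ) {A : Finset (Fin n)}
    {m : ℕ} (hA : A.card = m + 1) {θ : ℝ} (h0 : 0 < θ) (h1 : θ < 1) (x : ℝ) :
    μ.real {ω | x < throughput ρ (fun j i => g j i ω) A} ≤
      ((1 - θ)⁻¹) ^ (m + 1) * Real.exp (-(θ * x)) ^ m := by
  have hθ : 0 ≤ (1 - θ)⁻¹ := inv_nonneg.2 (by linarith)
  let F : Fin n → (Fin n → ℝ) → ENNReal := fun i x =>
    ENNReal.ofReal (Real.exp (θ * (m * Real.log (1 + x i / (1 / ρ + ∑ j ∈ A.erase i, x j)))))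
  have hF : ∀ i, Measurable (F i) := fun i => by fun_prop
  have hlin : ∫⁻ ω, ENNReal.ofReal (Real.exp (θ * m * throughput ρ (fun j i => g j i ω) A)) ∂μ ≤
      ENNReal.ofReal (((1 - θ)⁻¹) ^ (m + 1)) := by
    calc ∫⁻ ω, ENNReal.ofReal (Real.exp (θ * m * throughput ρ (fun j i => g j i ω) A)) ∂μ
        = ∫⁻ ω, ∏ i ∈ A, F i (fun j => g j i ω) ∂μ := by
          refine lintegral_congr fun ω => ?_
          simp only [F]
          rw [← ENNReal.ofReal_prod_of_nonneg fun i _ => (Real.exp_pos _).le, ← Real.exp_sum,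
            throughput, Finset.mul_sum]
          simp only [mul_assoc]
          rfl
      _ = ∏ i ∈ A, ∫⁻ ω, F i (fun j => g j i ω) ∂μ := hg.lintegral_prod_columns hF A
      _ ≤ ∏ i ∈ A, ENNReal.ofReal (1 - θ)⁻¹ := by
          refine Finset.prod_le_prod' fun i hi => ?_
          exact lintegral_exp_mul_le_of_tail ((hg.measurable_rate A i).const_mul (m : ℝ))
            (fun r hr => hg.measureReal_lt_rate_le hρ hi hA hr) h0 h1
      _ = _ := by rw [Finset.prod_const, hA, ENNReal.ofReal_pow hθ]
  have hmeas : Measurable fun ω => throughput ρ (fun j i => g j i ω) A :=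
    Finset.measurable_sum _ fun i _ => hg.measurable_rate A i
  have hE : 0 < Real.exp (θ * m * x) := Real.exp_pos _
  have hmark := mul_meas_ge_le_lintegral (μ := μ)
    (f := fun ω => ENNReal.ofReal (Real.exp (θ * m * throughput ρ (fun j i => g j i ω) A)))
    (by fun_prop) (ENNReal.ofReal (Real.exp (θ * m * x)))
  have hsub : μ {ω | x < throughput ρ (fun j i => g j i ω) A} ≤ μ {ω |
      ENNReal.ofReal (Real.exp (θ * m * x)) ≤
        ENNReal.ofReal (Real.exp (θ * m * throughput ρ (fun j i => g j i ω) A))} := by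
    refine measure_mono fun ω hω => ENNReal.ofReal_le_ofReal (Real.exp_le_exp.2 ?_)
    exact mul_le_mul_of_nonneg_left (le_of_lt hω) (by positivity)
  have h3 : ENNReal.ofReal (Real.exp (θ * m * x)) *
      μ {ω | x < throughput ρ (fun j i => g j i ω) A} ≤ ENNReal.ofReal (((1 - θ)⁻¹) ^ (m + 1)) :=
    (mul_le_mul_right hsub _).trans (hmark.trans hlin)
  have h4 : Real.exp (θ * m * x) * μ.real {ω | x < throughput ρ (fun j i => g j i ω) A} ≤
      ((1 - θ)⁻¹) ^ (m + 1) := by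
    rw [← ENNReal.ofReal_le_ofReal_iff (by positivity), ENNReal.ofReal_mul hE.le,
      ofReal_measureReal]
    exact h3
  have h5 : Real.exp (-(θ * x)) ^ m = (Real.exp (θ * m * x))⁻¹ := by
    rw [← Real.exp_nat_mul, ← Real.exp_neg]
    ring_nf
  rw [h5, ← div_eq_mul_inv, le_div_iff₀ hE, mul_comm]
  exact h4

/-- Union bound over all active sets with more than `K` links. -/
theorem measureReal_exists_lt_throughput_le [IsProbabilityMeasure μ]
    (hg : RayleighGains μ g) (hρ : 0 < ρ) {θ : ℝ}
    (h0 : 0 < θ) (h1 : θ < 1) (x : ℝ) (K : ℕ)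
    (hx : n * ((1 - θ)⁻¹ * Real.exp (-(θ * x))) ≤ 1) :
    μ.real {ω | ∃ A : Finset (Fin n), K < A.card ∧ x < throughput ρ (fun j i => g j i ω) A} ≤
      n * (n * (1 - θ)⁻¹ * (n * ((1 - θ)⁻¹ * Real.exp (-(θ * x)))) ^ K) := by
  have hθ : 0 < (1 - θ)⁻¹ := inv_pos.2 (by linarith)
  have hsub : {ω | ∃ A : Finset (Fin n), K < A.card ∧ x < throughput ρ (fun j i => g j i ω) A} ⊆
      ⋃ m ∈ (Finset.range n).filter (fun m => K ≤ m),
        ⋃ A ∈ (Finset.univ : Finset (Fin n)).powersetCard (m + 1),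
          {ω | x < throughput ρ (fun j i => g j i ω) A} := by
    rintro ω ⟨A, hK, hA⟩
    have hn : A.card ≤ n := by simpa using A.card_le_univ
    simp only [Set.mem_iUnion]
    refine ⟨A.card - 1, ?_, A, ?_, hA⟩
    · simp only [Finset.mem_filter, Finset.mem_range]
      omega
    · rw [Finset.mem_powersetCard]
      exact ⟨Finset.subset_univ _, by omega⟩
  set q := n * ((1 - θ)⁻¹ * Real.exp (-(θ * x))) with hq
  have hq0 : 0 ≤ q := by positivity
  calc _ ≤ _ := measureReal_mono hsub (measure_ne_top _ _)
    _ ≤ ∑ m ∈ (Finset.range n).filter (fun m => K ≤ m),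
        ∑ A ∈ (Finset.univ : Finset (Fin n)).powersetCard (m + 1),
          μ.real {ω | x < throughput ρ (fun j i => g j i ω) A} :=
        (measureReal_biUnion_finset_le _ _).trans
          (Finset.sum_le_sum fun m _ => measureReal_biUnion_finset_le _ _)
    _ ≤ ∑ m ∈ (Finset.range n).filter (fun m => K ≤ m), n * (1 - θ)⁻¹ * q ^ K := by
        refine Finset.sum_le_sum fun m hm => ?_
        have hm' := (Finset.mem_filter.1 hm).2
        calc _ ≤ ∑ A ∈ (Finset.univ : Finset (Fin n)).powersetCard (m + 1),
              ((1 - θ)⁻¹) ^ (m + 1) * Real.exp (-(θ * x)) ^ m :=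
              Finset.sum_le_sum fun A hA =>
                hg.measureReal_lt_throughput_le hρ (Finset.mem_powersetCard.1 hA).2 h0 h1 x
          _ = (n.choose (m + 1) : ℝ) * (((1 - θ)⁻¹) ^ (m + 1) * Real.exp (-(θ * x)) ^ m) := by
              rw [Finset.sum_const, Finset.card_powersetCard, Finset.card_univ, Fintype.card_fin,
                nsmul_eq_mul]
          _ ≤ (n : ℝ) ^ (m + 1) * (((1 - θ)⁻¹) ^ (m + 1) * Real.exp (-(θ * x)) ^ m) := by
              gcongr
              exact_mod_cast Nat.choose_le_pow n (m + 1)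
          _ = n * (1 - θ)⁻¹ * q ^ m := by rw [hq]; ring
          -- As `q ≤ 1`, the worst term is `m = K`; there are at most `n` terms.
          _ ≤ n * (1 - θ)⁻¹ * q ^ K :=
              mul_le_mul_of_nonneg_left (pow_le_pow_of_le_one hq0 hx hm') (by positivity)
    _ ≤ _ := by
        rw [Finset.sum_const, nsmul_eq_mul]
        refine mul_le_mul_of_nonneg_right ?_ (by positivity)
        exact_mod_cast (Finset.card_filter_le _ _).trans (by simp)

theorem measureReal_exists_lt_gain_le (hg : RayleighGains μ g) {s : ℝ} (hs : 0 ≤ s) :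
    μ.real {ω | ∃ i, s < g i i ω} ≤ n * Real.exp (-s) := by
  have h : {ω | ∃ i, s < g i i ω} = ⋃ i ∈ (Finset.univ : Finset (Fin n)), {ω | s < g i i ω} := by
    ext; simp
  rw [h]
  refine (measureReal_biUnion_finset_le _ _).trans (le_of_eq ?_)
  simp [measureReal_lt_of_hasLaw_exp (hg.law _ _) hs]

/-- Without interference the ratio is at most `ρ * s`. This handles the small sets, which the union
bound leaves out. -/
theorem throughput_le_of_gain_le (hg : RayleighGains μ g) (hρ : 0 < ρ) {ω : Ω} {s : ℝ} (hs : 0 ≤ s)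
    (h : ∀ i, g i i ω ≤ s) {K : ℕ} {A : Finset (Fin n)} (hA : A.card ≤ K) :
    throughput ρ (fun j i => g j i ω) A ≤ K * Real.log (1 + ρ * s) := by
  calc throughput ρ (fun j i => g j i ω) A ≤ ∑ i ∈ A, Real.log (1 + ρ * s) := by
        refine Finset.sum_le_sum fun i _ => Real.log_le_log
          (by linarith [hg.sinr_pos hρ A i ω]) (add_le_add_right ?_ 1)
        rw [sinr, div_le_iff₀ (add_pos_of_pos_of_nonneg (by positivity)
          (Finset.sum_nonneg fun j _ => (hg.pos j i ω).le))]
        have h1 : 0 ≤ ρ * s * ∑ j ∈ A.erase i, g j i ω :=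
          mul_nonneg (by positivity) (Finset.sum_nonneg fun j _ => (hg.pos j i ω).le)
        have h2 : ρ * s * (1 / ρ) = s := by field_simp
        rw [mul_add, h2]
        linarith [h i]
    _ = A.card * Real.log (1 + ρ * s) := by rw [Finset.sum_const, nsmul_eq_mul]
    _ ≤ K * Real.log (1 + ρ * s) := by
        refine mul_le_mul_of_nonneg_right (by exact_mod_cast hA) (Real.log_nonneg ?_)
        nlinarith

end RayleighGains

end Network

/-! ### Lower tail of the throughput under the threshold strategy. -/

namespace Network

variable {n : ℕ} {Ω : Type*} [MeasurableSpace Ω] {μ : Measure Ω}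
  {g : Fin n → Fin n → Ω → ℝ} {ρ : ℝ}

theorem mem_tblas {Δ : ℝ} {h : Fin n → Fin n → ℝ} {i : Fin n} : i ∈ tblas Δ h ↔ Δ < h i i := by
  simp [tblas]

namespace RayleighGains

/-- With `p = exp (-Δ)`, the transform is `1 - (1 - e⁻¹) p ≤ 1 - p / 2 ≤ exp (-p / 2)`, since `e ≥
2`. -/
theorem mgf_indicator_le [IsProbabilityMeasure μ] (hg : RayleighGains μ g) {Δ : ℝ} (hΔ : 0 ≤ Δ)
    (i : Fin n) :
    mgf (fun ω => if Δ < g i i ω then (1 : ℝ) else 0) μ (-1) ≤ Real.exp (-(Real.exp (-Δ) / 2)) := by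
  have hS : MeasurableSet {ω | Δ < g i i ω} := measurableSet_lt measurable_const (hg.measurable i i)
  have h1 : ∀ ω, Real.exp (-1 * if Δ < g i i ω then (1 : ℝ) else 0) =
      1 - (1 - Real.exp (-1)) * {ω | Δ < g i i ω}.indicator 1 ω := fun ω => by
    by_cases h : Δ < g i i ω <;> simp [Set.indicator, h]
  have hint : Integrable ({ω | Δ < g i i ω}.indicator (1 : Ω → ℝ)) μ :=
    (integrable_const (1 : ℝ)).indicator hS
  have he : Real.exp (-1) ≤ 1 / 2 := by
    rw [Real.exp_neg, one_div]
    exact inv_anti₀ two_pos (by linarith [Real.exp_one_gt_d9])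
  rw [mgf]
  simp_rw [h1]
  rw [integral_sub (integrable_const _) (hint.const_mul _), integral_const_mul,
    integral_indicator_one hS, measureReal_lt_of_hasLaw_exp (hg.law i i) hΔ]
  simp only [integral_const, probReal_univ, one_smul]
  have h2 := Real.add_one_le_exp (-(Real.exp (-Δ) / 2))
  nlinarith [Real.exp_pos (-Δ)]

/-- With threshold `Δ`, the number of active links is rarely below a quarter of its mean. -/
theorem measureReal_card_tblas_le [IsProbabilityMeasure μ] (hg : RayleighGains μ g) {Δ : ℝ}
    (hΔ : 0 ≤ Δ) :
    μ.real {ω | ((tblas Δ fun j i => g j i ω).card : ℝ) ≤ n * Real.exp (-Δ) / 4} ≤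
      Real.exp (-(n * Real.exp (-Δ) / 4)) := by
  have hgm := hg.measurable
  let Y : Fin n → Ω → ℝ := fun i ω => if Δ < g i i ω then (1 : ℝ) else 0
  have hstep : Measurable fun x : ℝ => if Δ < x then (1 : ℝ) else 0 :=
    Measurable.ite measurableSet_Ioi measurable_const measurable_const
  have hYm : ∀ i, Measurable (Y i) := fun i => hstep.comp (hgm i i)
  have hY : iIndepFun Y μ :=
    (hg.indep.precomp (g := fun i => (i, i)) fun _ _ h => (Prod.ext_iff.1 h).1).comp
      (fun _ x => if Δ < x then (1 : ℝ) else 0) fun _ => hstep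
  have hcard : ∀ ω, ((tblas Δ fun j i => g j i ω).card : ℝ) = (∑ i, Y i) ω := fun ω => by
    simp [tblas, Y]
  simp_rw [hcard]
  have hbd : ∀ ω, ‖Real.exp (-1 * (∑ i, Y i) ω)‖ ≤ 1 := fun ω => by
    rw [Real.norm_eq_abs, Real.abs_exp, Real.exp_le_one_iff, ← hcard]
    simp
  have hint : Integrable (fun ω => Real.exp (-1 * (∑ i, Y i) ω)) μ :=
    Integrable.of_bound (by fun_prop) 1 (ae_of_all _ hbd)
  refine (measure_le_le_exp_mul_mgf _ (by norm_num : (-1 : ℝ) ≤ 0) hint).trans ?_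
  rw [hY.mgf_sum hYm]
  calc _ ≤ Real.exp (- -1 * (n * Real.exp (-Δ) / 4)) *
        ∏ _i : Fin n, Real.exp (-(Real.exp (-Δ) / 2)) :=
        mul_le_mul_of_nonneg_left (Finset.prod_le_prod (fun _ _ => mgf_nonneg)
          fun i _ => hg.mgf_indicator_le hΔ i) (Real.exp_pos _).le
    _ = Real.exp (-(n * Real.exp (-Δ) / 4)) := by
        rw [Finset.prod_const, Finset.card_univ, Fintype.card_fin, ← Real.exp_nat_mul,
          ← Real.exp_add]
        ring_nf

/-- Chernoff bound for the total interference inside a fixed set of active links. -/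
theorem measureReal_le_sum_offDiag_le [IsProbabilityMeasure μ] (hg : RayleighGains μ g)
    (B : Finset (Fin n)) {δ : ℝ} (hδ : 0 < δ) :
    μ.real {ω | (1 + δ) * B.offDiag.card ≤ ∑ p ∈ B.offDiag, g p.1 p.2 ω} ≤
      ((1 + δ) * Real.exp (-δ)) ^ B.offDiag.card := by
  -- `δ / (1 + δ)` is the optimal Chernoff parameter: it minimises `(1 - θ)⁻¹ * exp (-θ (1 + δ))`.
  have hθ : δ / (1 + δ) < 1 := by rw [div_lt_one (by positivity)]; linarith
  have hmeas : ∀ p : Fin n × Fin n, Measurable (g p.1 p.2) := fun p => hg.measurable p.1 p.2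
  have hint : Integrable (fun ω => Real.exp (δ / (1 + δ) * (∑ p ∈ B.offDiag, g p.1 p.2) ω)) μ :=
    hg.indep.integrable_exp_mul_sum hmeas
      fun p _ => integrable_exp_mul_of_hasLaw_exp (hg.law p.1 p.2) hθ
  have h := measure_ge_le_exp_mul_mgf ((1 + δ) * B.offDiag.card)
    (by positivity : 0 ≤ δ / (1 + δ)) hint
  rw [hg.indep.mgf_sum hmeas,
    Finset.prod_congr rfl fun p _ => mgf_of_hasLaw_exp (hg.law p.1 p.2) hθ,
    Finset.prod_const] at h
  simp only [Finset.sum_apply] at h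
  refine h.trans (le_of_eq ?_)
  have e1 : (1 - δ / (1 + δ))⁻¹ = 1 + δ := by field_simp; ring
  have e2 : -(δ / (1 + δ)) * ((1 + δ) * (B.offDiag.card : ℝ)) = B.offDiag.card * -δ := by
    field_simp
  rw [e1, e2, Real.exp_nat_mul, mul_pow, mul_comm]

/-- Activation depends on the diagonal gains only, interference on the off-diagonal ones. -/
theorem measureReal_tblas_eq_and (hg : RayleighGains μ g) (B : Finset (Fin n)) (Δ x : ℝ) :
    μ.real {ω | (tblas Δ fun j i => g j i ω) = B ∧ x ≤ ∑ p ∈ B.offDiag, g p.1 p.2 ω} =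
      μ.real {ω | (tblas Δ fun j i => g j i ω) = B} *
        μ.real {ω | x ≤ ∑ p ∈ B.offDiag, g p.1 p.2 ω} := by
  let D : Finset (Fin n × Fin n) := Finset.univ.filter fun p => p.1 = p.2
  have hdisj : Disjoint D B.offDiag := by
    rw [Finset.disjoint_left]
    intro p hp hp'
    exact (Finset.mem_offDiag.1 hp').2.2 (by simpa [D] using hp)
  have h := hg.indep.indepFun_finset D B.offDiag hdisj fun p => hg.measurable p.1 p.2
  let U : Set (D → ℝ) := ⋂ i : Fin n, {x | Δ < x ⟨(i, i), by simp [D]⟩ ↔ i ∈ B}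
  let V : Set (B.offDiag → ℝ) := {y | x ≤ ∑ p : B.offDiag, y p}
  have hU : MeasurableSet U := by
    refine MeasurableSet.iInter fun i => ?_
    have hm : MeasurableSet {x : D → ℝ | Δ < x ⟨(i, i), by simp [D]⟩} :=
      measurableSet_lt measurable_const (by fun_prop)
    by_cases hi : i ∈ B
    · simpa [hi] using hm
    · simp only [hi, iff_false]
      exact hm.compl
  have hV : MeasurableSet V := measurableSet_le measurable_const (by fun_prop)
  have h2 := h.measure_inter_preimage_eq_mul U V hU hV
  have eU : {ω | (tblas Δ fun j i => g j i ω) = B} =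
      (fun ω (p : D) => g p.1.1 p.1.2 ω) ⁻¹' U := by
    ext ω
    simp [U, Finset.ext_iff, mem_tblas]
  have eV : {ω | x ≤ ∑ p ∈ B.offDiag, g p.1 p.2 ω} =
      (fun ω (p : B.offDiag) => g p.1.1 p.1.2 ω) ⁻¹' V := by
    ext ω
    have := Finset.sum_coe_sort B.offDiag fun p => g p.1 p.2 ω
    simp only [V, Set.mem_preimage, Set.mem_ofPred_eq, this]
  have e : {ω | (tblas Δ fun j i => g j i ω) = B ∧ x ≤ ∑ p ∈ B.offDiag, g p.1 p.2 ω} =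
      {ω | (tblas Δ fun j i => g j i ω) = B} ∩ {ω | x ≤ ∑ p ∈ B.offDiag, g p.1 p.2 ω} := rfl
  rw [e, eU, eV, measureReal_def, h2, ENNReal.toReal_mul]
  rfl

/-- The possible active sets partition the space, so by independence the probability is an average
of the fixed-set bounds, with no union-bound cost. -/
theorem measureReal_tblas_interference_le [IsProbabilityMeasure μ] (hg : RayleighGains μ g)
    (Δ : ℝ) {δ : ℝ} (hδ : 0 < δ) (K : ℕ) :
    μ.real {ω | K < (tblas Δ fun j i => g j i ω).card ∧
        (1 + δ) * (tblas Δ fun j i => g j i ω).offDiag.card ≤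
          ∑ p ∈ (tblas Δ fun j i => g j i ω).offDiag, g p.1 p.2 ω} ≤
      ((1 + δ) * Real.exp (-δ)) ^ K := by
  set r := (1 + δ) * Real.exp (-δ) with hr
  have hr0 : 0 ≤ r := by positivity
  have hr1 : r ≤ 1 := by
    rw [hr, Real.exp_neg, ← div_eq_mul_inv, div_le_one (Real.exp_pos _), add_comm]
    exact Real.add_one_le_exp δ
  let S : Finset (Finset (Fin n)) := Finset.univ.filter fun B => K < B.card
  have hdisj : Set.PairwiseDisjoint (S : Set (Finset (Fin n)))
      fun B => {ω | (tblas Δ fun j i => g j i ω) = B} := fun B _ B' _ hBB' =>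
    Set.disjoint_left.2 fun ω h h' => hBB' (h.symm.trans h')
  have hmeas : ∀ B ∈ S, MeasurableSet {ω | (tblas Δ fun j i => g j i ω) = B} := fun B _ => by
    have : {ω | (tblas Δ fun j i => g j i ω) = B} = ⋂ i, {ω | Δ < g i i ω ↔ i ∈ B} := by
      ext ω
      simp [Finset.ext_iff, mem_tblas]
    rw [this]
    refine MeasurableSet.iInter fun i => ?_
    have hm : MeasurableSet {ω | Δ < g i i ω} :=
      measurableSet_lt measurable_const (hg.measurable i i)
    by_cases hi : i ∈ B
    · simpa [hi] using hm
    · simp only [hi, iff_false]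
      exact hm.compl
  calc _ ≤ μ.real (⋃ B ∈ S, {ω | (tblas Δ fun j i => g j i ω) = B ∧
          (1 + δ) * B.offDiag.card ≤ ∑ p ∈ B.offDiag, g p.1 p.2 ω}) := by
        refine measureReal_mono (fun ω hω => ?_) (measure_ne_top _ _)
        simp only [Set.mem_iUnion]
        exact ⟨_, by simpa [S] using hω.1, rfl, hω.2⟩
    _ ≤ ∑ B ∈ S, μ.real {ω | (tblas Δ fun j i => g j i ω) = B ∧
          (1 + δ) * B.offDiag.card ≤ ∑ p ∈ B.offDiag, g p.1 p.2 ω} :=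
        measureReal_biUnion_finset_le _ _
    _ ≤ ∑ B ∈ S, μ.real {ω | (tblas Δ fun j i => g j i ω) = B} * r ^ K := by
        refine Finset.sum_le_sum fun B hB => ?_
        rw [hg.measureReal_tblas_eq_and]
        refine mul_le_mul_of_nonneg_left ?_ measureReal_nonneg
        refine (hg.measureReal_le_sum_offDiag_le B hδ).trans (pow_le_pow_of_le_one hr0 hr1 ?_)
        have hK : K < B.card := by simpa [S] using hB
        rw [Finset.offDiag_card, ← Nat.mul_sub_one]
        calc K ≤ B.card - 1 := by omega
          _ ≤ B.card * (B.card - 1) := Nat.le_mul_of_pos_left _ (by omega)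
    _ = μ.real (⋃ B ∈ S, {ω | (tblas Δ fun j i => g j i ω) = B}) * r ^ K := by
        rw [← Finset.sum_mul, measureReal_biUnion_finset hdisj hmeas]
    _ ≤ 1 * r ^ K := mul_le_mul_of_nonneg_right measureReal_le_one (by positivity)
    _ = r ^ K := one_mul _

/-- If all active direct gains exceed `Δ` and the average interference is at most `(1 + δ)` times
the number of interferers, the throughput is nearly `Δ`. -/
theorem le_throughput (hg : RayleighGains μ g) (hρ : 0 < ρ) {ω : Ω} {A : Finset (Fin n)}
    {Δ δ : ℝ} (hΔ : 0 < Δ) (hδ : 0 < δ) (hA : ∀ i ∈ A, Δ ≤ g i i ω) (hne : A.Nonempty)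
    (hcard : 1 / ρ + Δ ≤ δ * A.card)
    (hI : ∑ p ∈ A.offDiag, g p.1 p.2 ω ≤ (1 + δ) * A.offDiag.card) :
    Δ / (1 + 2 * δ) ≤ throughput ρ (fun j i => g j i ω) A := by
  have hk : (0:ℝ) < A.card := by exact_mod_cast hne.card_pos
  have hI0 : ∀ i, 0 ≤ ∑ j ∈ A.erase i, g j i ω :=
    fun i => Finset.sum_nonneg fun j _ => (hg.pos j i ω).le
  have hρ' : 0 < 1 / ρ := by positivity
  have hy : ∀ i ∈ A, 0 < 1 / ρ + ∑ j ∈ A.erase i, g j i ω + Δ := fun i _ => by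
    linarith [hI0 i]
  have hsum : ∑ i ∈ A, ∑ j ∈ A.erase i, g j i ω = ∑ p ∈ A.offDiag, g p.1 p.2 ω := by
    rw [Finset.sum_comm' (t' := A) (s' := fun j => A.erase j), Finset.sum_sigma']
    · refine Finset.sum_bij' (fun x _ => (x.1, x.2)) (fun p _ => ⟨p.1, p.2⟩) ?_ ?_ ?_ ?_ ?_
      · simp +contextual [Finset.mem_offDiag, eq_comm]
      · simp +contextual [Finset.mem_offDiag, eq_comm]
      · simp
      · simp
      · simp
    · intro i j
      simp only [Finset.mem_erase]
      tauto
  have hoff : (A.offDiag.card : ℝ) ≤ A.card * A.card := by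
    rw [Finset.offDiag_card]
    exact_mod_cast Nat.sub_le _ _
  have htot : ∑ i ∈ A, (1 / ρ + ∑ j ∈ A.erase i, g j i ω + Δ) ≤
      A.card * A.card * (1 + 2 * δ) := by
    rw [Finset.sum_add_distrib, Finset.sum_add_distrib, hsum]
    simp only [Finset.sum_const, nsmul_eq_mul]
    -- With `k = A.card`, noise and `Δ` contribute at most `δ k²` in total, interference at most `(1
    -- + δ) k²`.
    have h1 := mul_le_mul_of_nonneg_left hcard hk.le
    have h2 := mul_le_mul_of_nonneg_left hoff (by linarith : 0 ≤ 1 + δ)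
    linarith
  calc Δ / (1 + 2 * δ) = Δ * ((∑ _i ∈ A, (1:ℝ)) ^ 2 / (A.card * A.card * (1 + 2 * δ))) := by
        simp only [Finset.sum_const, nsmul_eq_mul, mul_one]
        field_simp
    _ ≤ Δ * ((∑ _i ∈ A, (1:ℝ)) ^ 2 / ∑ i ∈ A, (1 / ρ + ∑ j ∈ A.erase i, g j i ω + Δ)) := by
        have := Finset.sum_pos hy hne
        gcongr
    _ ≤ Δ * ∑ i ∈ A, 1 ^ 2 / (1 / ρ + ∑ j ∈ A.erase i, g j i ω + Δ) :=
        -- Cauchy–Schwarz in Sedrakyan's form: only the total interference matters, not its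
        -- distribution over receivers.
        mul_le_mul_of_nonneg_left (Finset.sq_sum_div_le_sum_sq_div _ _ hy) hΔ.le
    _ ≤ throughput ρ (fun j i => g j i ω) A := by
        rw [Finset.mul_sum]
        refine Finset.sum_le_sum fun i hi => ?_
        set y := 1 / ρ + ∑ j ∈ A.erase i, g j i ω with hyd
        have hy0 : 0 < y := by linarith [hI0 i]
        have hs : Δ / y ≤ sinr ρ (fun j i => g j i ω) A i :=
          div_le_div_of_nonneg_right (hA i hi) hy0.le
        -- That is, `log (1 + Δ / y) ≥ Δ / (y + Δ)`.
        have h1 := Real.one_sub_inv_le_log_of_pos (x := 1 + Δ / y) (by positivity)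
        have h2 : Δ * (1 ^ 2 / (y + Δ)) = 1 - (1 + Δ / y)⁻¹ := by field_simp; ring
        rw [h2]
        exact h1.trans (Real.log_le_log (by positivity) (by linarith))

theorem measureReal_throughput_tblas_lt_le [IsProbabilityMeasure μ] (hg : RayleighGains μ g)
    (hρ : 0 < ρ) {Δ δ : ℝ} (hΔ : 0 < Δ) (hδ : 0 < δ) {K : ℕ} (hK : K ≤ n * Real.exp (-Δ) / 4)
    (hcard : 1 / ρ + Δ ≤ δ * K) :
    μ.real {ω | throughput ρ (fun j i => g j i ω) (tblas Δ fun j i => g j i ω) <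
        Δ / (1 + 2 * δ)} ≤
      Real.exp (-(n * Real.exp (-Δ) / 4)) + ((1 + δ) * Real.exp (-δ)) ^ K := by
  refine (measureReal_mono ?_ (measure_ne_top _ _)).trans ((measureReal_union_le _ _).trans
    (add_le_add (hg.measureReal_card_tblas_le hΔ.le)
      (hg.measureReal_tblas_interference_le Δ hδ K)))
  intro ω hω
  by_contra hcon
  rw [Set.mem_union, not_or] at hcon
  obtain ⟨h1, h2⟩ := hcon
  simp only [Set.mem_ofPred_eq, not_le, not_and] at h1 h2 hω
  have hlt : K < (tblas Δ fun j i => g j i ω).card := by exact_mod_cast hK.trans_lt h1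
  refine hω.not_ge (hg.le_throughput hρ hΔ hδ (fun i hi => (mem_tblas.1 hi).le)
    (Finset.card_pos.1 (by omega)) (hcard.trans ?_) (h2 hlt).le)
  gcongr

end RayleighGains

end Network

/-! ### From vanishing tails to a.a.s. equivalence. -/

section AAS

variable {Ω : ℕ → Type*} [∀ n, MeasurableSpace (Ω n)] {μ : ∀ n, Measure (Ω n)}

theorem AASEquiv.congr_ae {X Y : ∀ n, Ω n → ℝ} {f : ℕ → ℝ} (hY : AASEquiv μ Y f)
    (h : ∀ n, X n =ᵐ[μ n] Y n) : AASEquiv μ X f := by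
  intro ε hε
  refine (hY ε hε).congr fun n => measure_congr ?_
  filter_upwards [h n] with ω hω
  exact propext (show |Y n ω / f n - 1| ≤ ε ↔ |X n ω / f n - 1| ≤ ε by rw [hω])

variable [∀ n, IsProbabilityMeasure (μ n)]

theorem AAS.of_compl_le {E : ∀ n, Set (Ω n)} {b : ℕ → ℝ} (hb : Tendsto b atTop (𝓝 0))
    (h : ∀ᶠ n in atTop, (μ n).real (E n)ᶜ ≤ b n) : AAS μ E := by
  have h1 : Tendsto (fun n => 1 - ENNReal.ofReal (b n)) atTop (𝓝 1) := by
    have := ENNReal.Tendsto.sub (tendsto_const_nhds (x := (1 : ENNReal)) (f := atTop))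
      (ENNReal.tendsto_ofReal hb) (Or.inl ENNReal.one_ne_top)
    simpa using this
  refine tendsto_of_tendsto_of_tendsto_of_le_of_le' h1 tendsto_const_nhds ?_
    (Eventually.of_forall fun n => prob_le_one)
  filter_upwards [h] with n hn
  rw [tsub_le_iff_right]
  have h2 : μ n (E n)ᶜ ≤ ENNReal.ofReal (b n) := by
    rw [← ofReal_measureReal]
    exact ENNReal.ofReal_le_ofReal hn
  calc 1 = μ n (E n ∪ (E n)ᶜ) := by rw [Set.union_compl_self, measure_univ]
    _ ≤ μ n (E n) + μ n (E n)ᶜ := measure_union_le _ _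
    _ ≤ _ := add_le_add_right h2 _

theorem AASEquiv.of_tendsto_tails {X : ∀ n, Ω n → ℝ} {f : ℕ → ℝ} (hf : ∀ᶠ n in atTop, 0 < f n)
    (hlow : ∀ ε, 0 < ε → Tendsto (fun n => (μ n).real {ω | X n ω < (1 - ε) * f n}) atTop (𝓝 0))
    (hup : ∀ ε, 0 < ε → Tendsto (fun n => (μ n).real {ω | (1 + ε) * f n < X n ω}) atTop (𝓝 0)) :
    AASEquiv μ X f := by
  intro ε hε
  have hb := (hlow ε hε).add (hup ε hε)
  rw [add_zero] at hb
  refine AAS.of_compl_le hb ?_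
  filter_upwards [hf] with n hn
  refine (measureReal_mono (fun ω hω => ?_) (measure_ne_top _ _)).trans (measureReal_union_le _ _)
  by_contra hcon
  rw [Set.mem_union, not_or] at hcon
  obtain ⟨h1, h2⟩ := hcon
  simp only [Set.mem_ofPred_eq, not_lt] at h1 h2
  refine hω (show |X n ω / f n - 1| ≤ ε from abs_le.2 ⟨?_, ?_⟩)
  · have := (le_div_iff₀ hn).2 h1
    linarith
  · have := (div_le_iff₀ hn).2 h2
    linarith

end AAS

/-! ### Asymptotics of the two tail bounds. -/

namespace Network

theorem tendsto_log_natCast : Tendsto (fun n : ℕ => Real.log n) atTop atTop :=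
  Real.tendsto_log_atTop.comp tendsto_natCast_atTop_atTop

theorem throughput_le_maxThroughput {n : ℕ} (ρ : ℝ) (h : Fin n → Fin n → ℝ) (A : Finset (Fin n)) :
    throughput ρ h A ≤ maxThroughput ρ h :=
  Finset.le_sup' (throughput ρ h) (Finset.mem_univ A)

theorem eventually_log_one_add_mul_le {c : ℝ} (hc : 0 < c) (K : ℕ) :
    ∀ᶠ x : ℝ in atTop, K * Real.log (1 + c * x) ≤ x := by
  have h1 : Tendsto (fun x : ℝ => 1 + c * x) atTop atTop :=
    tendsto_atTop_add_const_left _ _ (tendsto_id.const_mul_atTop hc)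
  have h2 := (Real.isLittleO_log_id_atTop.comp_tendsto h1).bound
    (show (0:ℝ) < 1 / ((K + 1) * (1 + c)) by positivity)
  filter_upwards [h2, eventually_ge_atTop 1] with x hx hx1
  have hpos : 0 < 1 + c * x := by positivity
  simp only [Function.comp_apply, id_eq, Real.norm_eq_abs, abs_of_pos hpos] at hx
  have h3 : (K : ℝ) * Real.log (1 + c * x) ≤ (K + 1) * (1 / ((K + 1) * (1 + c)) * (1 + c * x)) := by
    have := mul_le_mul_of_nonneg_left ((le_abs_self _).trans hx) (by positivity : (0:ℝ) ≤ K)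
    have : 0 ≤ 1 / ((K + 1) * (1 + c)) * (1 + c * x) := by positivity
    linarith
  refine h3.trans ?_
  have h4 : (K + 1) * (1 / ((K + 1) * (1 + c)) * (1 + c * x)) = (1 + c * x) / (1 + c) := by
    field_simp
  rw [h4, div_le_iff₀ (by positivity)]
  nlinarith

variable {Ω : ℕ → Type*} [∀ n, MeasurableSpace (Ω n)] {μ : ∀ n, Measure (Ω n)}
  [∀ n, IsProbabilityMeasure (μ n)] {g : ∀ n, Fin n → Fin n → Ω n → ℝ} {ρ : ℝ}

theorem tendsto_measureReal_lt_maxThroughput (hg : ∀ n, RayleighGains (μ n) (g n)) (hρ : 0 < ρ)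
    {ε : ℝ} (hε : 0 < ε) :
    Tendsto (fun n => (μ n).real
      {ω | (1 + ε) * Real.log n < maxThroughput ρ fun j i => g n j i ω}) atTop (𝓝 0) := by
  -- Makes `θ (1 + ε) = 1 + ε / 2`, so the ratio in the union bound is a constant times `n ^ (-ε /
  -- 2)`, with `θ` still below 1.
  set θ : ℝ := (1 + ε / 2) / (1 + ε) with hθ
  have hθ0 : 0 < θ := by positivity
  have hθ1 : θ < 1 := by rw [hθ, div_lt_one (by positivity)]; linarith
  set a : ℝ := (1 - θ)⁻¹ with ha
  have ha0 : 0 < a := inv_pos.2 (by linarith)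
  -- Then `n² * n ^ (-K ε / 2) ≤ n⁻¹`, which absorbs both factors `n` of the union bound.
  obtain ⟨K, hK⟩ := exists_nat_ge (6 / ε)
  have hKε : 3 ≤ K * (ε / 2) := by
    rw [div_le_iff₀ hε] at hK
    linarith
  have hinv : Tendsto (fun n : ℕ => Real.exp (-Real.log n)) atTop (𝓝 0) :=
    Real.tendsto_exp_neg_atTop_nhds_zero.comp tendsto_log_natCast
  have hb : Tendsto (fun n : ℕ => a ^ (K + 1) * Real.exp (-Real.log n) + Real.exp (-Real.log n))
      atTop (𝓝 0) := by
    simpa using (hinv.const_mul (a ^ (K + 1))).add hinv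
  have hq : ∀ᶠ n : ℕ in atTop, a * Real.exp (-(ε / 2 * Real.log n)) ≤ 1 := by
    have h1 : Tendsto (fun n : ℕ => a * Real.exp (-(ε / 2 * Real.log n))) atTop (𝓝 (a * 0)) :=
      (Real.tendsto_exp_neg_atTop_nhds_zero.comp
        (tendsto_log_natCast.const_mul_atTop (by positivity : 0 < ε / 2))).const_mul a
    rw [mul_zero] at h1
    exact h1.eventually_le_const one_pos
  refine tendsto_of_tendsto_of_tendsto_of_le_of_le' tendsto_const_nhds hb
    (Eventually.of_forall fun n => measureReal_nonneg) ?_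
  filter_upwards [hq, tendsto_log_natCast.eventually
    (eventually_log_one_add_mul_le (by positivity : 0 < ρ * 2) K), eventually_ge_atTop 1]
    with n hqn hKn hn
  have hn0 : (0:ℝ) < n := by exact_mod_cast hn
  set L := Real.log n with hL
  have hL0 : 0 ≤ L := Real.log_natCast_nonneg n
  have hnL : (n : ℝ) = Real.exp L := (Real.exp_log hn0).symm
  have hθx : θ * ((1 + ε) * L) = L + ε / 2 * L := by
    rw [hθ]
    field_simp
  have hq' : (n : ℝ) * (a * Real.exp (-(θ * ((1 + ε) * L)))) =
      a * Real.exp (-(ε / 2 * L)) := by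
    rw [hθx, hnL, mul_left_comm, ← Real.exp_add]
    ring_nf
  have hbig := (hg n).measureReal_exists_lt_throughput_le hρ hθ0 hθ1 ((1 + ε) * L) K
    (hq'.trans_le hqn)
  rw [hq'] at hbig
  have hgain := (hg n).measureReal_exists_lt_gain_le (by positivity : 0 ≤ 2 * L)
  refine (measureReal_mono (fun ω hω => ?_) (measure_ne_top _ _)).trans
    ((measureReal_union_le _ _).trans (add_le_add (hbig.trans ?_) (hgain.trans_eq ?_)))
  · by_contra hcon
    rw [Set.mem_union, not_or] at hcon
    obtain ⟨h1, h2⟩ := hcon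
    simp only [Set.mem_ofPred_eq, not_exists, not_and, not_lt] at h1 h2
    refine (Set.mem_ofPred_eq ▸ hω).not_ge (Finset.sup'_le _ _ fun A _ => ?_)
    rcases lt_or_ge K A.card with hA | hA
    · exact h1 A hA
    · refine ((hg n).throughput_le_of_gain_le hρ (by positivity) h2 hA).trans ?_
      rw [← mul_assoc]
      nlinarith
  · rw [mul_pow, ← Real.exp_nat_mul, hnL]
    calc Real.exp L * (Real.exp L * a * (a ^ K * Real.exp (K * -(ε / 2 * L))))
        = a ^ (K + 1) * (Real.exp L * Real.exp L * Real.exp (K * -(ε / 2 * L))) := by ring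
      _ = a ^ (K + 1) * Real.exp (L + L + K * -(ε / 2 * L)) := by
          rw [Real.exp_add, Real.exp_add]
      _ ≤ a ^ (K + 1) * Real.exp (-L) := by
          gcongr
          nlinarith
  · rw [hnL, ← Real.exp_add]
    ring_nf

/-- The error term matters only through being eventually below 1: this keeps `n * exp (-Δ n)` at
least of order `(log n)²` and `Δ n ≥ (1 - δ) log n`. -/
theorem tendsto_measureReal_throughput_tblas_lt (hg : ∀ n, RayleighGains (μ n) (g n)) (hρ : 0 < ρ)
    {Δ : ℕ → ℝ} (hΔ : (fun n : ℕ => Δ n -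
      (Real.log n - 2 * Real.log (Real.log n) + Real.log 2)) =O[atTop]
        (fun n : ℕ => Real.log (Real.log n) / Real.log n)) {ε : ℝ} (hε : 0 < ε) :
    Tendsto (fun n => (μ n).real {ω | throughput ρ (fun j i => g n j i ω)
      (tblas (Δ n) fun j i => g n j i ω) < (1 - ε) * Real.log n}) atTop (𝓝 0) := by
  have hdiff := hΔ.trans_tendsto
    (Real.isLittleO_log_id_atTop.tendsto_div_nhds_zero.comp tendsto_log_natCast)
  -- `3 δ ≤ ε` gives `(1 - ε)(1 + 2 δ) ≤ 1 - δ`.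
  obtain ⟨δ, hδ0, hδε, hδ1⟩ : ∃ δ : ℝ, 0 < δ ∧ 3 * δ ≤ ε ∧ δ < 1 :=
    ⟨min (ε / 3) (1 / 2), by positivity, by linarith [min_le_left (ε / 3) (1 / 2 : ℝ)],
      (min_le_right _ _).trans_lt (by norm_num)⟩
  -- The exponent 2 covers the error (below 1) plus `log 2`; the 4 is the quarter of the mean number
  -- of active links.
  set κ : ℝ := Real.exp (-2) / 4 with hκ
  have hκ0 : 0 < κ := by positivity
  have hclose : ∀ᶠ n : ℕ in atTop, |Δ n -
      (Real.log n - 2 * Real.log (Real.log n) + Real.log 2)| < 1 := by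
    have := hdiff.eventually (Metric.ball_mem_nhds 0 one_pos)
    simpa using this
  have hloglog : ∀ᶠ x : ℝ in atTop, 2 * Real.log x + 1 ≤ δ * x := by
    filter_upwards [Real.isLittleO_log_id_atTop.bound (by positivity : 0 < δ / 4),
      eventually_ge_atTop (2 / δ), eventually_ge_atTop 0] with x h1 h2 h3
    simp only [id_eq, Real.norm_eq_abs, abs_of_nonneg h3] at h1
    rw [div_le_iff₀ hδ0] at h2
    linarith [le_abs_self (Real.log x)]
  -- `x + 2` will dominate `Δ n`, and the `- 1` pays for rounding the number of links down.
  have hquad : ∀ᶠ x : ℝ in atTop, 1 / ρ + (x + 2) ≤ δ * (κ * x ^ 2 - 1) := by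
    filter_upwards [eventually_ge_atTop (2 / (δ * κ)), eventually_ge_atTop (1 / ρ + 2 + δ)]
      with x h1 h2
    rw [div_le_iff₀ (by positivity)] at h1
    have h3 : 0 ≤ x := le_trans (by positivity) h2
    nlinarith
  have hmean : ∀ᶠ n : ℕ in atTop, κ * Real.log n ^ 2 ≤ n * Real.exp (-Δ n) / 4 := by
    filter_upwards [hclose, tendsto_log_natCast.eventually (eventually_ge_atTop 1),
      eventually_ge_atTop 1] with n h1 h2 h3
    have hn0 : (0:ℝ) < n := by exact_mod_cast h3
    have h4 : Real.exp (2 * Real.log (Real.log n) - 2) ≤ Real.exp (Real.log n + -Δ n) := by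
      refine Real.exp_le_exp.2 ?_
      linarith [(abs_lt.1 h1).2, Real.log_two_lt_d9]
    rw [Real.exp_add, Real.exp_log hn0, sub_eq_add_neg, Real.exp_add,
      show 2 * Real.log (Real.log n) = ((2:ℕ):ℝ) * Real.log (Real.log n) by norm_num,
      Real.exp_nat_mul, Real.exp_log (by linarith)] at h4
    rw [hκ]
    linarith
  have hu : Tendsto (fun n : ℕ => (n : ℝ) * Real.exp (-Δ n) / 4) atTop atTop :=
    tendsto_atTop_mono' _ hmean
      (((tendsto_pow_atTop two_ne_zero).comp tendsto_log_natCast).const_mul_atTop hκ0)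
  have hr1 : (1 + δ) * Real.exp (-δ) < 1 := by
    rw [Real.exp_neg, ← div_eq_mul_inv, div_lt_one (Real.exp_pos _), add_comm]
    exact Real.add_one_lt_exp hδ0.ne'
  have hb : Tendsto (fun n : ℕ => Real.exp (-(n * Real.exp (-Δ n) / 4)) +
      ((1 + δ) * Real.exp (-δ)) ^ ⌊(n : ℝ) * Real.exp (-Δ n) / 4⌋₊) atTop (𝓝 0) := by
    have h1 := Real.tendsto_exp_neg_atTop_nhds_zero.comp hu
    have h2 := (tendsto_pow_atTop_nhds_zero_of_lt_one (by positivity) hr1).comp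
      (tendsto_nat_floor_atTop.comp hu)
    simpa using h1.add h2
  refine tendsto_of_tendsto_of_tendsto_of_le_of_le' tendsto_const_nhds hb
    (Eventually.of_forall fun n => measureReal_nonneg) ?_
  filter_upwards [hclose, hmean, tendsto_log_natCast.eventually hloglog,
    tendsto_log_natCast.eventually hquad, tendsto_log_natCast.eventually (eventually_ge_atTop 1)]
    with n h1 h2 h3 h4 h5
  set L := Real.log n with hL
  have hll : 0 ≤ Real.log L := Real.log_nonneg h5
  have hl2 := Real.log_pos one_lt_two
  have hl2' := Real.log_two_lt_d9
  obtain ⟨h1l, h1u⟩ := abs_lt.1 h1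
  have hΔL : (1 - δ) * L ≤ Δ n := by linarith
  have hΔ0 : 0 < Δ n := by nlinarith
  have hfl := Nat.lt_floor_add_one ((n : ℝ) * Real.exp (-Δ n) / 4)
  have hcard : 1 / ρ + Δ n ≤ δ * (⌊(n : ℝ) * Real.exp (-Δ n) / 4⌋₊ : ℝ) := by
    have : δ * (κ * L ^ 2 - 1) ≤ δ * (⌊(n : ℝ) * Real.exp (-Δ n) / 4⌋₊ : ℝ) :=
      mul_le_mul_of_nonneg_left (by linarith) hδ0.le
    linarith
  refine (measureReal_mono (fun ω hω => ?_) (measure_ne_top _ _)).trans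
    ((hg n).measureReal_throughput_tblas_lt_le hρ hΔ0 hδ0
      (Nat.floor_le (by positivity)) hcard)
  refine lt_of_lt_of_le (Set.mem_ofPred_eq ▸ hω) ?_
  rw [le_div_iff₀ (by positivity)]
  refine le_trans ?_ hΔL
  rw [mul_right_comm]
  refine mul_le_mul_of_nonneg_right ?_ (by linarith)
  nlinarith

end Network

theorem mainTheorem1
    {Ω : ℕ → Type*} [∀ n, MeasurableSpace (Ω n)]
    (μ : ∀ n, Measure (Ω n)) [∀ n, IsProbabilityMeasure (μ n)]
    (P η : ℝ) (hP : 0 < P) (hη : 0 < η)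
    (g : ∀ n, Fin n → Fin n → Ω n → ℝ)
    (hlaw : ∀ n, ∀ j i : Fin n, HasLaw (g n j i) (expMeasure 1) (μ n))
    (hindep : ∀ n, iIndepFun (fun p : Fin n × Fin n => g n p.1 p.2) (μ n)) :
    AASEquiv μ (fun n ω => Network.maxThroughput (P / η) (fun j i => g n j i ω))
        (fun n => Real.log n) ∧
      ∀ Δ : ℕ → ℝ,
        (fun n : ℕ => Δ n -
            (Real.log n - 2 * Real.log (Real.log n) + Real.log 2)) =O[atTop]
          (fun n : ℕ => Real.log (Real.log n) / Real.log n) →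
        AASEquiv μ
          (fun n ω => Network.throughput (P / η) (fun j i => g n j i ω)
            (Network.tblas (Δ n) (fun j i => g n j i ω)))
          (fun n => Real.log n) := by
  have hρ : 0 < P / η := div_pos hP hη
  choose g' hg' hae using fun n => Network.exists_rayleighGains_ae_eq (hlaw n) (hindep n)
  have hpos : ∀ᶠ n : ℕ in atTop, 0 < Real.log n :=
    Network.tendsto_log_natCast.eventually (eventually_gt_atTop 0)
  have hup := fun ε (hε : 0 < ε) => Network.tendsto_measureReal_lt_maxThroughput hg' hρ hε
  constructor
  -- The lower tail of the maximum comes from TBLAS at the threshold with zero error term.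
  · have hΔ : (fun n : ℕ => (Real.log n - 2 * Real.log (Real.log n) + Real.log 2) -
        (Real.log n - 2 * Real.log (Real.log n) + Real.log 2)) =O[atTop]
          (fun n : ℕ => Real.log (Real.log n) / Real.log n) := by
      simp only [sub_self]
      exact isBigO_zero _ _
    have hX := AASEquiv.of_tendsto_tails (μ := μ)
      (X := fun n ω => Network.maxThroughput (P / η) fun j i => g' n j i ω) hpos
      (fun ε hε => squeeze_zero (fun n => measureReal_nonneg)
        (fun n => measureReal_mono (fun ω hω =>
          (Network.throughput_le_maxThroughput _ _ _).trans_lt hω) (measure_ne_top _ _))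
        (Network.tendsto_measureReal_throughput_tblas_lt hg' hρ hΔ hε)) hup
    refine hX.congr_ae fun n => ?_
    filter_upwards [hae n] with ω hω
    rw [hω]
  · intro Δ hΔ
    have hX := AASEquiv.of_tendsto_tails (μ := μ)
      (X := fun n ω => Network.throughput (P / η) (fun j i => g' n j i ω)
        (Network.tblas (Δ n) fun j i => g' n j i ω)) hpos
      (fun ε hε => Network.tendsto_measureReal_throughput_tblas_lt hg' hρ hΔ hε)
      (fun ε hε => squeeze_zero (fun n => measureReal_nonneg)
        (fun n => measureReal_mono (fun ω hω =>
          lt_of_lt_of_le hω (Network.throughput_le_maxThroughput _ _ _)) (measure_ne_top _ _))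
        (hup ε hε))
    refine hX.congr_ae fun n => ?_
    filter_upwards [hae n] with ω hω
    rw [hω]
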